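/- Consider the box-ball system on boxes indexed by $\mathbb Z$: a state is a finite set of filled boxes, and one time step moves every ball exactly once, always taking the left-most ball not yet moved and moving it to the left-most empty box to its right. Let $(\eta_t)_{t\in\mathbb Z}$ be a two-sided orbit of this evolution. A block is a maximal run of consecutive filled boxes; numbering the blocks of $\eta_t$ from left to right, let $Q_i^t$ be the number of balls in the $i$-th block and $W_i^t$ the number of empty boxes between the $i$-th and the $(i+1)$-st block. Assume that the orbit is an $n$-soliton, i.e. $\eta_t$ has exactly $n$ blocks for all large $t$, with asymptotic block sizes $$\mu_i=\lim_{t\to+\infty}Q_i^t\quad(1\le i\le n),\qquad \mu_1<\mu_2<\dots<\mu_n .$$ Then for every $k\in\{1,\dots,n-1\}$, $$\lim_{t\to+\infty}\Big(W_{n-k}^{t}+Q_{n-k}^{t}+W_{k}^{-t}+Q_{k}^{-t}+2t(\mu_{n-k}-\mu_{n-k+1})\Big) =\sum_{j<k+1}2\mu_{n-k}+\sum_{j>k}2\mu_{n-j+1}-\sum_{j>k+1}2\mu_{n-j+1}-\sum_{j<k}2\mu_{n-k+1},$$ where all the sums run over $j\in\{1,\dots,n\}$ subject to the indicated condition. 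-/

import Mathlib

namespace BoxBall

/-- A state of the (basic) box-ball system: the finite set of filled boxes among the boxes
indexed by `ℤ`, at most one ball in each box. -/
abbrev State : Type := Finset ℤ

theorem exists_empty_right (s : State) (x : ℤ) : ∃ d : ℕ, x + 1 + (d : ℤ) ∉ s := by
  by_contra h
  push Not at h
  have hinj : Function.Injective (fun d : ℕ => x + 1 + (d : ℤ)) := by
    intro a b hab
    simpa using hab
  exact (Set.infinite_range_of_injective hinj)
    (s.finite_toSet.subset (by rintro _ ⟨d, rfl⟩; exact h d))

/-- The left-most empty box strictly to the right of box `x`. -/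
def firstEmpty (s : State) (x : ℤ) : ℤ :=
  x + 1 + (Nat.find (exists_empty_right s x) : ℤ)

/-- Move the ball in box `x` to the left-most empty box to its right. -/
def moveBall (s : State) (x : ℤ) : State :=
  insert (firstEmpty s x) (s.erase x)

/-- One time step: every ball is moved exactly once, the balls being taken from left to right
(a ball that has moved is never the left-most ball not yet moved, so the order is that of the
initial positions). -/
def evolve (s : State) : State :=
  (s.sort (· ≤ ·)).foldl moveBall s

/-- A two-sided orbit `(η t)`, `t ∈ ℤ`, of the box-ball evolution. -/
def IsOrbit (η : ℤ → State) : Prop :=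
  ∀ t : ℤ, η (t + 1) = evolve (η t)

/-- The first boxes of the blocks (maximal runs of consecutive balls). -/
def blockStarts (s : State) : Finset ℤ :=
  s.filter (fun x => x - 1 ∉ s)

/-- The empty boxes that immediately follow a block. -/
def blockEnds (s : State) : Finset ℤ :=
  (s.image (fun x => x + 1)).filter (fun x => x ∉ s)

/-- The number of blocks. -/
def numBlocks (s : State) : ℕ :=
  (blockStarts s).card

/-- The first box of the `k`-th block from the left (`1 ≤ k ≤ numBlocks s`). -/
def blockStart (s : State) (k : ℕ) : ℤ :=
  ((blockStarts s).sort (· ≤ ·)).getD (k - 1) 0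

/-- The empty box that immediately follows the `k`-th block from the left
(`1 ≤ k ≤ numBlocks s`). -/
def blockEnd (s : State) (k : ℕ) : ℤ :=
  ((blockEnds s).sort (· ≤ ·)).getD (k - 1) 0

/-- `Q k`, the number of balls in the `k`-th block from the left (`1 ≤ k ≤ numBlocks s`). -/
def blockSize (s : State) (k : ℕ) : ℤ :=
  blockEnd s k - blockStart s k

/-- `W k`, the number of empty boxes between the `k`-th and the `(k + 1)`-st block
(`1 ≤ k < numBlocks s`). -/
def gapSize (s : State) (k : ℕ) : ℤ :=
  blockStart s (k + 1) - blockEnd s k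

/-- The orbit is an `n`-soliton with asymptotic block sizes `μ 1, …, μ n`: in large forward time
there are `n` blocks, and the size of the `k`-th block from the left tends to `μ k`. -/
def HasAsymptoticBlockSizes (η : ℤ → State) (n : ℕ) (μ : ℕ → ℝ) : Prop :=
  (∀ᶠ t in Filter.atTop, numBlocks (η t) = n) ∧
    ∀ k ∈ Finset.Icc 1 n,
      Filter.Tendsto (fun t : ℤ => (blockSize (η t) k : ℝ)) Filter.atTop (nhds (μ k))

end BoxBall

/-! The block sizes and gaps evolve by the ultradiscrete Toda molecule: a carrier sweeps from left
to right, unloads as many balls as the gap allows, then picks up the next block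
(`Interlaced.evolve_blocks_succ`, `todaStep_evolve`). This system has explicit solutions: sizes and
gaps are differences of tropical tau functions, where `tau` is the minimum over `k`-element sets of
solitons of a weight that is affine in time. They solve the equations because of a bilinear identity
(`tau_bilinear`), proved by exchanging parts of two minimizing sets. As the time tends to `+∞` the
`k` slowest solitons minimize, as it tends to `-∞` the `k` fastest, so both asymptotics are
explicit. Since sizes are integers, convergence means that they are eventually constant; the gaps
then grow linearly. The phases `c` can therefore be chosen so that an explicit solution agrees with
the orbit at one late time. A Toda step is injective (`TodaStep.injective`), so they agree at all
earlier times. In the sum of the gaps at `t` and `-t` the phases cancel and only the interaction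
terms remain (`eventually_gap_add_gap`). -/

namespace BoxBall

/-! ### Tropical tau functions -/

open Finset

/-- The tropical weight of the set `S` of solitons at time `t`: free motion plus pairwise
interaction `2 * min (m i) (m j)` (for monotone `m`). -/
def weight (c m : ℕ → ℤ) (t : ℤ) (S : Finset ℕ) : ℤ :=
  ∑ i ∈ S, (c i + t * m i) + 2 * ∑ i ∈ S, m i * ((S.filter (fun j => i < j)).card : ℤ)

/-- The tropical tau function: the least weight of a `k`-element subset of `range n`. -/
noncomputable def tau (c m : ℕ → ℤ) (n k : ℕ) (t : ℤ) : ℤ :=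
  sInf (((powersetCard k (range n)).image (weight c m t) : Finset ℤ) : Set ℤ)

theorem weight_add (c m : ℕ → ℤ) (t d : ℤ) (S : Finset ℕ) :
    weight c m (t + d) S = weight c m t S + d * ∑ i ∈ S, m i := by
  simp only [weight, add_mul, sum_add_distrib, mul_sum]
  ring

section tau

variable {c m : ℕ → ℤ} {n k : ℕ}

theorem tau_le {S : Finset ℕ} (hS : S ⊆ range n) (hk : S.card = k) (t : ℤ) :
    tau c m n k t ≤ weight c m t S :=
  csInf_le (Finset.bddBelow _)
    (mem_coe.2 (mem_image_of_mem _ (mem_powersetCard.2 ⟨hS, hk⟩)))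

theorem exists_tau_eq (h : k ≤ n) (t : ℤ) :
    ∃ S ⊆ range n, S.card = k ∧ weight c m t S = tau c m n k t := by
  have hne : ((powersetCard k (range n)).image (weight c m t)).Nonempty :=
    (powersetCard_nonempty.2 (by simpa using h)).image _
  have := hne.csInf_mem
  obtain ⟨S, hS, h2⟩ := mem_image.1 this
  exact ⟨S, (mem_powersetCard.1 hS).1, (mem_powersetCard.1 hS).2, h2⟩

theorem tau_eq_of_forall_le {R : Finset ℕ} {t : ℤ} (hR : R ⊆ range n) (hk : R.card = k)
    (h : ∀ S ⊆ range n, S.card = k → weight c m t R ≤ weight c m t S) :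
    tau c m n k t = weight c m t R := by
  refine le_antisymm (tau_le hR hk t) ?_
  have hkn : k ≤ n := by simpa [hk] using card_le_card hR
  obtain ⟨S, hS, hSk, e⟩ := exists_tau_eq (c := c) (m := m) hkn t
  exact e ▸ h S hS hSk

theorem tau_zero (t : ℤ) : tau c m n 0 t = 0 := by
  rw [tau_eq_of_forall_le (R := ∅) (by simp) (by simp)]
  · simp [weight]
  · intro S _ h
    rw [card_eq_zero.1 h]

theorem tau_self (t : ℤ) : tau c m n n t = weight c m t (range n) := by
  refine tau_eq_of_forall_le subset_rfl (by simp) fun S hS h => ?_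
  rw [eq_of_subset_of_card_le hS (by simp [h])]

theorem tau_self_linear (t : ℤ) :
    tau c m n n (t + 2) - tau c m n n (t + 1) = tau c m n n (t + 1) - tau c m n n t := by
  simp only [tau_self, weight_add]
  ring

/-! ### Exchange of parts and the bilinear identity -/

/-- The low part of `A` joined with the high part of `B`, cut at `p`. -/
def splice (p : ℕ) (A B : Finset ℕ) : Finset ℕ :=
  A.filter (· < p) ∪ B.filter (p ≤ ·)

theorem disjoint_low_high (p : ℕ) (A B : Finset ℕ) :
    Disjoint (A.filter (· < p)) (B.filter (p ≤ ·)) := by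
  rw [disjoint_left]
  intro x hx hy
  simp only [mem_filter] at hx hy
  omega

theorem card_splice (p : ℕ) (A B : Finset ℕ) :
    (splice p A B).card = (A.filter (· < p)).card + (B.filter (p ≤ ·)).card :=
  card_union_of_disjoint (disjoint_low_high p A B)

theorem splice_subset {p : ℕ} {A B U : Finset ℕ} (hA : A ⊆ U) (hB : B ⊆ U) :
    splice p A B ⊆ U :=
  union_subset ((filter_subset _ _).trans hA) ((filter_subset _ _).trans hB)

theorem splice_self (p : ℕ) (A : Finset ℕ) : splice p A A = A := by
  ext x
  simp only [splice, mem_union, mem_filter]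
  have := lt_or_ge x p
  tauto

/-- Every low element lies below every high one, so the interaction across the cut sees the high
part only through its cardinality. This is what makes exchanges computable. -/
theorem weight_splice (c m : ℕ → ℤ) (p : ℕ) (A B : Finset ℕ) (t : ℤ) :
    weight c m t (splice p A B) = weight c m t (A.filter (· < p)) +
      weight c m t (B.filter (p ≤ ·)) +
      2 * (B.filter (p ≤ ·)).card * ∑ i ∈ A.filter (· < p), m i := by
  have hd := disjoint_low_high p A B
  have h1 : ∀ i ∈ A.filter (· < p), m i * (((splice p A B).filter (fun j => i < j)).card : ℤ) =
      m i * (((A.filter (· < p)).filter (fun j => i < j)).card : ℤ) +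
        (B.filter (p ≤ ·)).card * m i := by
    intro i hi
    have hi' := (mem_filter.1 hi).2
    rw [splice, filter_union, card_union_of_disjoint (hd.mono (filter_subset _ _)
      (filter_subset _ _)), filter_true_of_mem (s := B.filter (p ≤ ·))]
    · push_cast
      ring
    · intro j hj
      have := (mem_filter.1 hj).2
      omega
  have h2 : ∀ i ∈ B.filter (p ≤ ·), m i * (((splice p A B).filter (fun j => i < j)).card : ℤ) =
      m i * (((B.filter (p ≤ ·)).filter (fun j => i < j)).card : ℤ) := by
    intro i hi
    have hi' := (mem_filter.1 hi).2
    rw [splice, filter_union, filter_false_of_mem (s := A.filter (· < p)), empty_union]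
    intro j hj
    have := (mem_filter.1 hj).2
    omega
  have h3 : ∑ i ∈ splice p A B, m i * (((splice p A B).filter (fun j => i < j)).card : ℤ) =
      ∑ i ∈ A.filter (· < p), m i * (((A.filter (· < p)).filter (fun j => i < j)).card : ℤ) +
      (B.filter (p ≤ ·)).card * ∑ i ∈ A.filter (· < p), m i +
      ∑ i ∈ B.filter (p ≤ ·), m i * (((B.filter (p ≤ ·)).filter (fun j => i < j)).card : ℤ) := by
    conv_lhs => rw [splice, sum_union hd, ← splice]
    rw [sum_congr rfl h1, sum_congr rfl h2, sum_add_distrib, mul_sum]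
  rw [weight, h3]
  conv_lhs => rw [splice, sum_union hd]
  simp only [weight]
  ring

/-- Exchanging the low parts of two sets whose high parts differ by one element in size does not
change the sum of their weights at times `t - 1` and `t + 1`. -/
theorem weight_splice_add_weight_splice {p : ℕ} {A B : Finset ℕ}
    (h : (A.filter (p ≤ ·)).card = (B.filter (p ≤ ·)).card + 1) (t : ℤ) :
    weight c m (t - 1) (splice p B A) + weight c m (t + 1) (splice p A B) =
      weight c m (t - 1) A + weight c m (t + 1) B := by
  conv_rhs => rw [← splice_self p A, ← splice_self p B]
  -- The cross terms change by twice the difference of the sums of `m` over the two low parts;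
  -- moving the low parts between times `t - 1` and `t + 1` changes the sum by the opposite amount.
  simp only [weight_splice, h, sub_eq_add_neg, weight_add]
  push_cast
  ring

theorem card_low_add_card_high (p : ℕ) (A : Finset ℕ) :
    (A.filter (· < p)).card + (A.filter (p ≤ ·)).card = A.card := by
  rw [← card_splice, splice_self]

theorem sum_eq_sum_increments {A : Finset ℕ} (hA : A ⊆ range n) :
    ∑ i ∈ A, m i = A.card * m 0 +
      ∑ p ∈ range n, (m (p + 1) - m p) * ((A.filter (p + 1 ≤ ·)).card : ℤ) := by
  have h1 : ∀ i ∈ A, m i = m 0 + ∑ p ∈ range n, if p + 1 ≤ i then m (p + 1) - m p else 0 := by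
    intro i hi
    have hi' := mem_range.1 (hA hi)
    rw [← sum_filter, show (range n).filter (fun p => p + 1 ≤ i) = range i by
      ext p; simp only [mem_filter, mem_range]; omega, sum_range_sub]
    ring
  rw [sum_congr rfl h1, sum_add_distrib, sum_const, nsmul_eq_mul, sum_comm]
  congr 1
  refine sum_congr rfl fun p _ => ?_
  rw [← sum_filter, sum_const, nsmul_eq_mul, mul_comm]

/-- Summation by parts: the coefficients of the high counts are the increments of `m`, which are
nonnegative. -/
theorem sum_le_sum_of_dominated (hm : Monotone m) {A B : Finset ℕ} (hA : A ⊆ range n)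
    (hB : B ⊆ range n) (hc : A.card = B.card)
    (h : ∀ p, (A.filter (p ≤ ·)).card ≤ (B.filter (p ≤ ·)).card) :
    ∑ i ∈ A, m i ≤ ∑ i ∈ B, m i := by
  rw [sum_eq_sum_increments hA, sum_eq_sum_increments hB, hc]
  refine add_le_add_right (sum_le_sum fun p _ => ?_) _
  exact mul_le_mul_of_nonneg_left (by exact_mod_cast h (p + 1))
    (sub_nonneg.2 (hm (Nat.le_succ p)))

theorem card_high_le_succ (p : ℕ) (A : Finset ℕ) :
    (A.filter (p ≤ ·)).card ≤ (A.filter (p + 1 ≤ ·)).card + 1 := by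
  have : A.filter (p ≤ ·) ⊆ insert p (A.filter (p + 1 ≤ ·)) := by
    intro x
    simp only [mem_filter, mem_insert]
    rintro ⟨h1, h2⟩
    rcases h2.eq_or_lt with h | h
    · exact Or.inl h.symm
    · exact Or.inr ⟨h1, h⟩
  exact (card_le_card this).trans (card_insert_le _ _)

theorem card_high_succ_le (p : ℕ) (A : Finset ℕ) :
    (A.filter (p + 1 ≤ ·)).card ≤ (A.filter (p ≤ ·)).card :=
  card_le_card (monotone_filter_right _ fun x _ (h : p + 1 ≤ x) => (Nat.le_of_succ_le h : p ≤ x))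

/-- If at some cut the high part of `A` is larger than that of `B`, then at some cut it is larger
by exactly one. -/
theorem exists_card_high_eq {A B : Finset ℕ} (hA : A ⊆ range n) {q : ℕ}
    (hq : (B.filter (q ≤ ·)).card < (A.filter (q ≤ ·)).card) :
    ∃ p, (A.filter (p ≤ ·)).card = (B.filter (p ≤ ·)).card + 1 := by
  by_contra hno
  push Not at hno
  -- When the cut moves up by one, the excess of `A` over `B` drops by at most one. If it never
  -- equals one it stays positive, which is absurd at the cut `q + n`, above all of `A`.
  have key : ∀ j, (B.filter (q + j ≤ ·)).card < (A.filter (q + j ≤ ·)).card := by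
    intro j
    induction j with
    | zero => exact hq
    | succ j ih =>
      have h1 := card_high_le_succ (q + j) A
      have h2 := card_high_succ_le (q + j) B
      have h3 := hno (q + j)
      have h4 := hno (q + (j + 1))
      rw [← add_assoc] at h4 ⊢
      omega
  have h5 := key n
  rw [filter_false_of_mem (s := A) (p := (q + n ≤ ·))] at h5
  · simp at h5
  · intro i hi
    have := mem_range.1 (hA hi)
    omega

/-- The tropical Toda bilinear identity. -/
theorem tau_bilinear (hm : Monotone m) (hk : k + 2 ≤ n) (t : ℤ) :
    tau c m n (k + 1) (t - 1) + tau c m n (k + 1) (t + 1) =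
      min (2 * tau c m n (k + 1) t) (tau c m n (k + 2) (t - 1) + tau c m n k (t + 1)) := by
  refine le_antisymm (le_min ?_ ?_) (min_le_iff.2 ?_)
  -- A minimizer at time `t` is a competitor at `t - 1` and `t + 1`, and its weight is affine in
  -- time.
  · obtain ⟨S, hS, hc, e⟩ := exists_tau_eq (c := c) (m := m) (show k + 1 ≤ n by omega) t
    have h1 := tau_le (c := c) (m := m) hS hc (t - 1)
    have h2 := tau_le (c := c) (m := m) hS hc (t + 1)
    rw [sub_eq_add_neg, weight_add] at h1
    rw [weight_add] at h2
    rw [sub_eq_add_neg]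
    linarith
  · obtain ⟨A, hA, hAc, eA⟩ := exists_tau_eq (c := c) (m := m) hk (t - 1)
    obtain ⟨B, hB, hBc, eB⟩ := exists_tau_eq (c := c) (m := m) (show k ≤ n by omega) (t + 1)
    -- At this cut, exchanging low parts turns sizes `k + 2` and `k` into `k + 1` twice.
    obtain ⟨p, hp⟩ := exists_card_high_eq hA (B := B) (q := 0) (by simp [hAc, hBc])
    have hA' := card_low_add_card_high p A
    have hB' := card_low_add_card_high p B
    rw [← eA, ← eB, ← weight_splice_add_weight_splice hp t]
    exact add_le_add (tau_le (splice_subset hB hA) (by rw [card_splice]; omega) _)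
      (tau_le (splice_subset hA hB) (by rw [card_splice]; omega) _)
  · obtain ⟨A, hA, hAc, eA⟩ := exists_tau_eq (c := c) (m := m) (show k + 1 ≤ n by omega) (t - 1)
    obtain ⟨B, hB, hBc, eB⟩ := exists_tau_eq (c := c) (m := m) (show k + 1 ≤ n by omega) (t + 1)
    rw [← eA, ← eB]
    -- If `B` dominates `A`, its slope is at least that of `A`, and moving both sets to time `t`
    -- does not raise the total weight. Otherwise an exchange produces sets of sizes `k + 2` and
    -- `k`.
    by_cases h : ∀ p, (A.filter (p ≤ ·)).card ≤ (B.filter (p ≤ ·)).card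
    · left
      have h1 := sum_le_sum_of_dominated hm hA hB (hAc.trans hBc.symm) h
      have h2 := tau_le (c := c) (m := m) hA hAc t
      have h3 := tau_le (c := c) (m := m) hB hBc t
      rw [sub_eq_add_neg, weight_add, weight_add]
      linarith
    · right
      push Not at h
      obtain ⟨q, hq⟩ := h
      obtain ⟨p, hp⟩ := exists_card_high_eq hA hq
      have hA' := card_low_add_card_high p A
      have hB' := card_low_add_card_high p B
      rw [← weight_splice_add_weight_splice hp t]
      exact add_le_add (tau_le (splice_subset hB hA) (by rw [card_splice]; omega) _)
        (tau_le (splice_subset hA hB) (by rw [card_splice]; omega) _)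

/-! ### Minimizing sets for large positive and negative times -/

theorem sum_lt_sum_of_separated {R S : Finset ℕ} (hc : R.card = S.card) (hne : R ≠ S)
    (h : ∀ i ∈ R, ∀ j ∈ S \ R, m i < m j) : ∑ i ∈ R, m i < ∑ i ∈ S, m i := by
  have hcard : (R \ S).card = (S \ R).card := by
    have h1 := card_sdiff_add_card_inter R S
    have h2 := card_sdiff_add_card_inter S R
    rw [inter_comm] at h2
    omega
  have hne' : (R \ S).Nonempty := by
    rw [sdiff_nonempty]
    exact fun hs => hne (eq_of_subset_of_card_le hs hc.ge)
  obtain ⟨i₀, hi₀, hmax⟩ := exists_max_image _ m hne'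
  have h1 : ∑ i ∈ R \ S, m i ≤ (R \ S).card • m i₀ := sum_le_card_nsmul _ _ _ hmax
  have h2 : ∑ i ∈ S \ R, m i₀ < ∑ i ∈ S \ R, m i :=
    sum_lt_sum_of_nonempty (card_pos.1 (hcard ▸ card_pos.2 hne'))
      fun j hj => h i₀ (mem_sdiff.1 hi₀).1 j hj
  rw [sum_const] at h2
  have h3 := sum_inter_add_sum_sdiff R S m
  have h4 := sum_inter_add_sum_sdiff S R m
  rw [inter_comm] at h4
  rw [hcard] at h1
  linarith

theorem eventually_tau_eq_atTop {R : Finset ℕ} (hR : R ⊆ range n) (hk : R.card = k)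
    (h : ∀ i ∈ R, ∀ j ∈ range n \ R, m i < m j) :
    ∀ᶠ t in Filter.atTop, tau c m n k t = weight c m t R := by
  have key : ∀ᶠ t in Filter.atTop, ∀ S ∈ powersetCard k (range n),
      weight c m t R ≤ weight c m t S := by
    refine (Filter.eventually_all_finset _).2 fun S hS => ?_
    obtain ⟨hS, hSk⟩ := mem_powersetCard.1 hS
    rcases eq_or_ne R S with rfl | hne
    · simp
    have hlt := sum_lt_sum_of_separated (m := m) (hk.trans hSk.symm) hne
      fun i hi j hj => h i hi j (sdiff_subset_sdiff hS subset_rfl hj)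
    -- The integer slopes differ by at least one, so a lead of `S` at time `0` is made up after as
    -- many steps.
    filter_upwards [Filter.eventually_ge_atTop 0,
      Filter.eventually_ge_atTop (weight c m 0 R - weight c m 0 S)] with t h0 ht
    rw [← zero_add t, weight_add, weight_add]
    nlinarith
  filter_upwards [key] with t ht
  exact tau_eq_of_forall_le hR hk fun S hS hSk => ht S (mem_powersetCard.2 ⟨hS, hSk⟩)

theorem eventually_tau_eq_atBot {R : Finset ℕ} (hR : R ⊆ range n) (hk : R.card = k)
    (h : ∀ i ∈ R, ∀ j ∈ range n \ R, m j < m i) :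
    ∀ᶠ t in Filter.atBot, tau c m n k t = weight c m t R := by
  have key : ∀ᶠ t in Filter.atBot, ∀ S ∈ powersetCard k (range n),
      weight c m t R ≤ weight c m t S := by
    refine (Filter.eventually_all_finset _).2 fun S hS => ?_
    obtain ⟨hS, hSk⟩ := mem_powersetCard.1 hS
    rcases eq_or_ne R S with rfl | hne
    · simp
    have hlt := sum_lt_sum_of_separated (m := fun i => - m i) (hk.trans hSk.symm) hne
      fun i hi j hj => neg_lt_neg (h i hi j (sdiff_subset_sdiff hS subset_rfl hj))
    rw [sum_neg_distrib, sum_neg_distrib, neg_lt_neg_iff] at hlt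
    filter_upwards [Filter.eventually_le_atBot 0,
      Filter.eventually_le_atBot (weight c m 0 S - weight c m 0 R)] with t h0 ht
    rw [← zero_add t, weight_add, weight_add]
    nlinarith
  filter_upwards [key] with t ht
  exact tau_eq_of_forall_le hR hk fun S hS hSk => ht S (mem_powersetCard.2 ⟨hS, hSk⟩)

theorem weight_singleton (i : ℕ) (t : ℤ) : weight c m t {i} = c i + t * m i := by
  simp [weight, filter_singleton]

theorem weight_range_succ (i : ℕ) (t : ℤ) :
    weight c m t (range (i + 1)) = weight c m t (range i) + c i + t * m i +
      2 * ∑ j ∈ range i, m j := by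
  have h := weight_splice c m i (range (i + 1)) (range (i + 1)) t
  rw [splice_self, show (range (i + 1)).filter (· < i) = range i by
      ext; simp only [mem_filter, mem_range]; omega,
    show (range (i + 1)).filter (i ≤ ·) = {i} by
      ext; simp only [mem_filter, mem_range, mem_singleton]; omega] at h
  rw [h, weight_singleton, card_singleton]
  push_cast
  ring

theorem weight_Ico_pred {l u : ℕ} (h : l < u) (t : ℤ) :
    weight c m t (Ico l u) = weight c m t (Ico (l + 1) u) + c l + t * m l +
      2 * (u - l - 1) * m l := by
  have h' := weight_splice c m (l + 1) (Ico l u) (Ico l u) t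
  rw [splice_self, show (Ico l u).filter (· < l + 1) = {l} by
      ext; simp only [mem_filter, mem_Ico, mem_singleton]; omega,
    show (Ico l u).filter (l + 1 ≤ ·) = Ico (l + 1) u by
      ext; simp only [mem_filter, mem_Ico]; omega] at h'
  rw [h', weight_singleton, Nat.card_Ico, sum_singleton, Nat.cast_sub (show l + 1 ≤ u from h)]
  push_cast
  ring

end tau

end BoxBall

/-! ### One time step as a carrier sweep -/

namespace BoxBall

open Finset

theorem lt_firstEmpty (s : State) (x : ℤ) : x < firstEmpty s x := by
  unfold firstEmpty
  omega

theorem firstEmpty_notMem (s : State) (x : ℤ) : firstEmpty s x ∉ s :=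
  Nat.find_spec (exists_empty_right s x)

theorem mem_of_lt_firstEmpty {s : State} {x y : ℤ} (h1 : x < y) (h2 : y < firstEmpty s x) :
    y ∈ s := by
  unfold firstEmpty at h2
  have := Nat.find_min (exists_empty_right s x) (m := (y - x - 1).toNat) (by omega)
  rw [not_not] at this
  convert this using 1
  omega

theorem firstEmpty_eq {s : State} {x y : ℤ} (h1 : x < y) (h2 : y ∉ s)
    (h3 : ∀ z, x < z → z < y → z ∈ s) : firstEmpty s x = y := by
  rcases lt_trichotomy (firstEmpty s x) y with h | h | h
  · exact absurd (h3 _ (lt_firstEmpty s x) h) (firstEmpty_notMem s x)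
  · exact h
  · exact absurd (mem_of_lt_firstEmpty h1 h) h2

/-- Add a ball at the left-most empty box not to the left of `x`. -/
def addBall (x : ℤ) (s : State) : State :=
  insert (firstEmpty s (x - 1)) s

theorem addBall_of_notMem {s : State} {x : ℤ} (h : x ∉ s) : addBall x s = insert x s := by
  rw [addBall, firstEmpty_eq (by omega) h fun z _ _ => by omega]

/-- If the moved ball lands left of `x`, the two operations do not interfere. Otherwise both aim at
the same empty box; whichever comes second takes the next one, and balls are indistinguishable. -/
theorem addBall_moveBall (s : State) {x z : ℤ} (h : z < x) :
    moveBall (addBall x s) z = addBall x (moveBall s z) := by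
  set f := firstEmpty s z with hf
  set g := firstEmpty s (x - 1) with hg
  have hzf : z < f := lt_firstEmpty s z
  have hxg : x - 1 < g := lt_firstEmpty s (x - 1)
  have hfs : f ∉ s := firstEmpty_notMem s z
  have hgs : g ∉ s := firstEmpty_notMem s (x - 1)
  have hf' : ∀ y, z < y → y < f → y ∈ s := fun y => mem_of_lt_firstEmpty
  have hg' : ∀ y, x - 1 < y → y < g → y ∈ s := fun y => mem_of_lt_firstEmpty
  have hA : addBall x s = insert g s := rfl
  have hM : moveBall s z = insert f (s.erase z) := rfl
  rcases lt_or_ge f x with hfx | hfx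
  · have e1 : firstEmpty (insert g s) z = f :=
      firstEmpty_eq hzf (by rw [mem_insert]; rintro (h | h); exacts [by omega, hfs h])
        fun y h1 h2 => mem_insert_of_mem (hf' y h1 h2)
    have e2 : firstEmpty (insert f (s.erase z)) (x - 1) = g :=
      firstEmpty_eq hxg
        (by rw [mem_insert, mem_erase]; rintro (h | h); exacts [by omega, hgs h.2])
        fun y h1 h2 => mem_insert_of_mem (mem_erase.2 ⟨by omega, hg' y h1 h2⟩)
    rw [hA, hM, addBall, moveBall, e1, e2, erase_insert_of_ne (by omega), Finset.insert_comm]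
  · have hfg : f = g := by
      refine firstEmpty_eq (by omega) hgs fun y h1 h2 => ?_
      rcases lt_or_ge y x with hy | hy
      · exact hf' y h1 (by omega)
      · exact hg' y (by omega) h2
    set f₂ := firstEmpty (insert g s) z with hf₂
    have h2 : z < f₂ := lt_firstEmpty _ _
    have h2s : f₂ ∉ insert g s := firstEmpty_notMem _ _
    have h2' : ∀ y, z < y → y < f₂ → y ∈ insert g s := fun y => mem_of_lt_firstEmpty
    rw [mem_insert, not_or] at h2s
    have hle : x - 1 < f₂ := by
      by_contra hlt
      exact h2s.2 (hf' f₂ h2 (by omega))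
    have e2 : firstEmpty (insert f (s.erase z)) (x - 1) = f₂ := by
      refine firstEmpty_eq hle ?_ fun y h1 h3 => ?_
      · rw [mem_insert, mem_erase, hfg]
        rintro (h | h)
        exacts [h2s.1 h, h2s.2 h.2]
      · have := h2' y (by omega) h3
        rw [mem_insert] at this
        rw [hfg, mem_insert, mem_erase]
        exact this.imp_right fun h => ⟨by omega, h⟩
    rw [hA, hM, addBall, moveBall, ← hf₂, e2, hfg, erase_insert_of_ne (by omega)]

theorem foldl_addBall {x : ℤ} (l : List ℤ) (h : ∀ z ∈ l, z < x) (s : State) :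
    l.foldl moveBall (addBall x s) = addBall x (l.foldl moveBall s) := by
  induction l generalizing s with
  | nil => rfl
  | cons z l ih =>
    rw [List.foldl_cons, List.foldl_cons, addBall_moveBall s (h z (by simp)),
      ih fun y hy => h y (by simp [hy])]

theorem sort_insert_max {s : Finset ℤ} {x : ℤ} (h : ∀ y ∈ s, y < x) :
    (insert x s).sort (· ≤ ·) = s.sort (· ≤ ·) ++ [x] := by
  have hx : x ∉ s := fun hx => lt_irrefl _ (h x hx)
  refine List.Perm.eq_of_pairwise' (r := (· ≤ ·)) (pairwise_sort _ _) ?_ ?_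
  · rw [List.pairwise_append]
    refine ⟨pairwise_sort _ _, by simp, fun a ha b hb => ?_⟩
    rw [List.mem_singleton.1 hb]
    exact (h a ((mem_sort _).1 ha)).le
  · refine (List.perm_ext_iff_of_nodup (sort_nodup _ _) ?_).2 fun a => ?_
    · refine List.Nodup.append (sort_nodup _ _) (by simp) ?_
      intro a ha hb
      rw [List.mem_singleton.1 hb] at ha
      exact hx ((mem_sort _).1 ha)
    · simp [or_comm]

/-- The right-most ball moves last, and by commutation it may be added after all the others have
moved. This permits induction on the balls from left to right. -/
theorem evolve_insert_max {s : State} {x : ℤ} (h : ∀ y ∈ s, y < x) :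
    evolve (insert x s) = moveBall (addBall x (evolve s)) x := by
  have hx : x ∉ s := fun hx => lt_irrefl _ (h x hx)
  rw [evolve, sort_insert_max h, List.foldl_append, ← addBall_of_notMem hx,
    foldl_addBall _ fun z hz => h z ((mem_sort _).1 hz)]
  rfl

theorem evolve_empty : evolve ∅ = ∅ := by
  simp [evolve]

/-- Effect of the evolution on a last block `[a, a + L)`, when `X` balls are carried over the
empty box `e` at the end of the preceding blocks. -/
theorem evolve_union_Ico {s C : State} {e a X : ℤ} (hs : ∀ y ∈ s, y < a) (hC : ∀ y ∈ C, y < e)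
    (hea : e ≤ a) (h : evolve s = C ∪ Ico e (e + X)) (L : ℕ) :
    evolve (s ∪ Ico a (a + L)) = C ∪ Ico e (e + min X (a - e)) ∪
      Ico (a + L) (a + L + (X - min X (a - e) + L)) := by
  induction L with
  | zero =>
    simp only [Nat.cast_zero, add_zero, Ico_self, union_empty, h]
    ext y
    simp only [mem_union, mem_Ico]
    by_cases hy : y ∈ C
    · simp [hy]
    · simp only [hy, false_or]
      omega
  | succ L ih =>
    have hins : s ∪ Ico a (a + (L + 1 : ℕ)) = insert (a + L : ℤ) (s ∪ Ico a (a + L)) := by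
      ext y
      simp only [mem_union, mem_Ico, mem_insert]
      by_cases hy : y ∈ s
      · simp [hy]
      · simp only [hy, false_or]
        push_cast
        omega
    rw [hins, evolve_insert_max, ih]
    -- `Y` is the load of the carrier at `x`. The added ball extends the run from `x` to length `Y +
    -- 1`; moving the ball at `x` then shifts this run by one box.
    · set Y := X - min X (a - e) + L with hY
      set C' := C ∪ Ico e (e + min X (a - e)) with hC'
      set x : ℤ := a + L with hx
      have hYnn : 0 ≤ Y := by omega
      have hlt : ∀ y ∈ C', y < x := by
        intro y hy
        rw [hC', mem_union, mem_Ico] at hy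
        rcases hy with hy | hy
        · have := hC y hy
          omega
        · omega
      have e1 : firstEmpty (C' ∪ Ico x (x + Y)) (x - 1) = x + Y := by
        refine firstEmpty_eq (by omega) ?_ fun z h1 h2 => ?_
        · rw [mem_union, mem_Ico]
          rintro (h | h)
          · have := hlt _ h
            omega
          · omega
        · rw [mem_union, mem_Ico]
          right
          omega
      have e2 : firstEmpty (insert (x + Y) (C' ∪ Ico x (x + Y))) x = x + Y + 1 := by
        refine firstEmpty_eq (by omega) ?_ fun z h1 h2 => ?_
        · rw [mem_insert, mem_union, mem_Ico]
          rintro (h | h | h)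
          · omega
          · have := hlt _ h
            omega
          · omega
        · rw [mem_insert, mem_union, mem_Ico]
          omega
      rw [addBall, e1, moveBall, e2]
      ext y
      simp only [mem_insert, mem_erase, mem_union, mem_Ico]
      by_cases hy : y ∈ C'
      · have := hlt y hy
        simp only [hy, true_or, or_true, and_true, iff_true]
        omega
      · simp only [hy, false_or]
        push_cast
        omega
    · intro y hy
      rw [mem_union, mem_Ico] at hy
      rcases hy with hy | hy
      · have := hs y hy
        omega
      · omega

/-! ### Block coordinates -/

/-- The state whose blocks are `[a i, e i)`, `i < n`. -/
noncomputable def blocks (n : ℕ) (a e : ℕ → ℤ) : State :=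
  (range n).biUnion fun i => Ico (a i) (e i)

/-- The `n` intervals `[a i, e i)` are nonempty, ordered and pairwise not adjacent. -/
structure Interlaced (n : ℕ) (a e : ℕ → ℤ) : Prop where
  start_lt_end : ∀ i, i < n → a i < e i
  end_lt_start : ∀ i, i + 1 < n → e i < a (i + 1)

theorem mem_blocks {n : ℕ} {a e : ℕ → ℤ} {x : ℤ} :
    x ∈ blocks n a e ↔ ∃ i < n, a i ≤ x ∧ x < e i := by
  simp [blocks]

theorem blocks_succ (n : ℕ) (a e : ℕ → ℤ) :
    blocks (n + 1) a e = blocks n a e ∪ Ico (a n) (e n) := by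
  rw [blocks, range_add_one, biUnion_insert, union_comm]
  rfl

theorem blocks_congr {n : ℕ} {a e a' e' : ℕ → ℤ} (ha : ∀ i < n, a i = a' i)
    (he : ∀ i < n, e i = e' i) : blocks n a e = blocks n a' e' :=
  biUnion_congr rfl fun i hi => by rw [ha i (mem_range.1 hi), he i (mem_range.1 hi)]

namespace Interlaced

variable {n : ℕ} {a e : ℕ → ℤ}

theorem of_succ (h : Interlaced (n + 1) a e) : Interlaced n a e :=
  ⟨fun i hi => h.1 i (by omega), fun i hi => h.2 i (by omega)⟩

theorem end_lt (h : Interlaced n a e) {i j : ℕ} (hij : i < j) (hj : j < n) : e i < a j := by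
  induction j, hij using Nat.le_induction with
  | base => exact h.2 i hj
  | succ j hij ih =>
    have h1 := ih (by omega)
    have h2 := h.1 j (by omega)
    have h3 := h.2 j hj
    omega

theorem lt_of_mem (h : Interlaced (n + 1) a e) {x : ℤ} (hx : x ∈ blocks n a e) : x + 1 < a n := by
  obtain ⟨i, hi, h1, h2⟩ := mem_blocks.1 hx
  have := h.end_lt hi (Nat.lt_succ_self n)
  omega

theorem end_notMem (h : Interlaced n a e) {i : ℕ} (hi : i < n) : e i ∉ blocks n a e := by
  intro hx
  obtain ⟨j, hj, h1, h2⟩ := mem_blocks.1 hx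
  rcases lt_trichotomy i j with hij | rfl | hij
  · have := h.end_lt hij hj
    omega
  · omega
  · have h3 := h.end_lt hij hi
    have h4 := h.1 i hi
    omega

theorem pred_start_notMem (h : Interlaced n a e) {i : ℕ} (hi : i < n) :
    a i - 1 ∉ blocks n a e := by
  intro hx
  obtain ⟨j, hj, h1, h2⟩ := mem_blocks.1 hx
  rcases lt_trichotomy i j with hij | rfl | hij
  · have h3 := h.end_lt hij hj
    have h4 := h.1 i hi
    omega
  · omega
  · have := h.end_lt hij hi
    omega

theorem blockStarts_eq (h : Interlaced n a e) : blockStarts (blocks n a e) = (range n).image a := by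
  ext x
  simp only [blockStarts, mem_filter, mem_image, mem_range]
  constructor
  · rintro ⟨h1, h2⟩
    obtain ⟨i, hi, h3, h4⟩ := mem_blocks.1 h1
    refine ⟨i, hi, ?_⟩
    by_contra hne
    exact h2 (mem_blocks.2 ⟨i, hi, by omega, by omega⟩)
  · rintro ⟨i, hi, rfl⟩
    exact ⟨mem_blocks.2 ⟨i, hi, le_rfl, h.1 i hi⟩, h.pred_start_notMem hi⟩

theorem blockEnds_eq (h : Interlaced n a e) : blockEnds (blocks n a e) = (range n).image e := by
  ext x
  simp only [blockEnds, mem_filter, mem_image, mem_range]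
  constructor
  · rintro ⟨⟨y, h1, rfl⟩, h2⟩
    obtain ⟨i, hi, h3, h4⟩ := mem_blocks.1 h1
    refine ⟨i, hi, ?_⟩
    by_contra hne
    exact h2 (mem_blocks.2 ⟨i, hi, by omega, by omega⟩)
  · rintro ⟨i, hi, rfl⟩
    have := h.1 i hi
    exact ⟨⟨e i - 1, mem_blocks.2 ⟨i, hi, by omega, by omega⟩, by omega⟩, h.end_notMem hi⟩

theorem start_lt_start (h : Interlaced n a e) {i j : ℕ} (hij : i < j) (hj : j < n) :
    a i < a j :=
  (h.1 i (hij.trans hj)).trans (h.end_lt hij hj)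

theorem end_lt_end (h : Interlaced n a e) {i j : ℕ} (hij : i < j) (hj : j < n) :
    e i < e j :=
  (h.end_lt hij hj).trans (h.1 j hj)

end Interlaced

theorem sort_image_range {n : ℕ} {f : ℕ → ℤ} (h : ∀ i j, i < j → j < n → f i < f j) :
    ((range n).image f).sort (· ≤ ·) = (List.range n).map f := by
  induction n with
  | zero => simp
  | succ n ih =>
    rw [range_add_one, image_insert, sort_insert_max, ih fun i j hij hj => h i j hij (by omega),
      List.range_succ, List.map_append, List.map_singleton]
    intro y hy
    obtain ⟨i, hi, rfl⟩ := mem_image.1 hy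
    exact h i n (mem_range.1 hi) (Nat.lt_succ_self n)

namespace Interlaced

variable {n : ℕ} {a e : ℕ → ℤ}

theorem numBlocks_eq (h : Interlaced n a e) : numBlocks (blocks n a e) = n := by
  rw [numBlocks, h.blockStarts_eq, ← length_sort (· ≤ ·),
    sort_image_range fun i j hij hj => h.start_lt_start hij hj]
  simp

theorem blockStart_eq (h : Interlaced n a e) {i : ℕ} (hi : i < n) :
    blockStart (blocks n a e) (i + 1) = a i := by
  rw [blockStart, h.blockStarts_eq, sort_image_range fun i j hij hj => h.start_lt_start hij hj]
  simp [List.getD, hi]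

theorem blockEnd_eq (h : Interlaced n a e) {i : ℕ} (hi : i < n) :
    blockEnd (blocks n a e) (i + 1) = e i := by
  rw [blockEnd, h.blockEnds_eq, sort_image_range fun i j hij hj => h.end_lt_end hij hj]
  simp [List.getD, hi]

end Interlaced

theorem exists_blocks (s : State) : ∃ n a e, Interlaced n a e ∧ s = blocks n a e := by
  induction s using Finset.induction_on_max with
  | empty => exact ⟨0, 0, 0, ⟨by simp, by simp⟩, rfl⟩
  | insert x s hlt ih =>
    obtain ⟨n, a, e, h, rfl⟩ := ih
    by_cases hx : ∃ k, n = k + 1 ∧ e k = x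
    · obtain ⟨k, rfl, rfl⟩ := hx
      refine ⟨k + 1, a, Function.update e k (e k + 1), ⟨fun i hi => ?_, fun i hi => ?_⟩, ?_⟩
      · have := h.1 i hi
        by_cases hik : i = k
        · subst hik
          simp only [Function.update_self]
          omega
        · rwa [Function.update_of_ne hik]
      · rw [Function.update_of_ne (by omega)]
        exact h.2 i hi
      · have hk := h.1 k (by omega)
        rw [blocks_succ, blocks_succ, Function.update_self,
          blocks_congr (e' := Function.update e k (e k + 1)) (fun _ _ => rfl)
            fun i hi => (Function.update_of_ne (by omega) _ _).symm]
        ext y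
        simp only [mem_insert, mem_union, mem_Ico]
        by_cases hy : y ∈ blocks k a (Function.update e k (e k + 1))
        · simp [hy]
        · simp only [hy, false_or]
          omega
    · refine ⟨n + 1, Function.update a n x, Function.update e n (x + 1),
        ⟨fun i hi => ?_, fun i hi => ?_⟩, ?_⟩
      · by_cases hik : i = n
        · subst hik
          simp
        · rw [Function.update_of_ne hik, Function.update_of_ne hik]
          exact h.1 i (by omega)
      · rw [Function.update_of_ne (by omega)]
        by_cases hik : i + 1 = n
        · subst hik
          rw [Function.update_self]
          have h1 := h.1 i (by omega)
          have h2 := hlt (e i - 1) (mem_blocks.2 ⟨i, by omega, by omega, by omega⟩)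
          have h3 : e i ≠ x := fun he => hx ⟨i, rfl, he⟩
          omega
        · rw [Function.update_of_ne hik]
          exact h.2 i (by omega)
      · rw [blocks_succ, Function.update_self, Function.update_self,
          blocks_congr (a := a) (e := e) (a' := Function.update a n x)
            (e' := Function.update e n (x + 1))
            (fun i hi => (Function.update_of_ne (by omega) _ _).symm)
            fun i hi => (Function.update_of_ne (by omega) _ _).symm]
        ext y
        simp only [mem_insert, mem_union, mem_Ico]
        by_cases hy : y ∈ blocks n (Function.update a n x) (Function.update e n (x + 1))
        · simp [hy]
        · simp only [hy, false_or, or_false]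
          omega

/-- The number of balls carried by the evolution at the end of the `i`-th block. -/
def carried (a e : ℕ → ℤ) : ℕ → ℤ
  | 0 => e 0 - a 0
  | i + 1 => carried a e i - min (carried a e i) (a (i + 1) - e i) + (e (i + 1) - a (i + 1))

theorem Interlaced.carried_pos {n : ℕ} {a e : ℕ → ℤ} (h : Interlaced n a e) :
    ∀ i, i < n → 0 < carried a e i
  | 0, hi => sub_pos.2 (h.1 0 hi)
  | i + 1, hi => by
    have := h.1 (i + 1) hi
    rw [carried]
    omega

/-- The carrier starts unloading where an old block ends, so the new blocks start at the old ends.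
Beyond the last block nothing limits the unloading. -/
theorem Interlaced.evolve_blocks_succ {a e : ℕ → ℤ} : ∀ {n : ℕ}, Interlaced (n + 1) a e →
    evolve (blocks (n + 1) a e) =
      blocks n e (fun i => e i + min (carried a e i) (a (i + 1) - e i)) ∪
        Ico (e n) (e n + carried a e n)
  | 0, h => by
    have h0 := h.1 0 (by omega)
    have := evolve_union_Ico (s := ∅) (C := ∅) (e := a 0) (a := a 0) (X := 0) (by simp) (by simp)
      le_rfl (by simp [evolve_empty]) (e 0 - a 0).toNat
    simpa [blocks, carried, h0.le] using this
  | n + 1, h => by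
    have hn := h.1 (n + 1) (by omega)
    have := evolve_union_Ico (a := a (n + 1)) (fun y hy => by have := h.lt_of_mem hy; omega)
      (fun y hy => ?_) (h.2 n (by omega)).le h.of_succ.evolve_blocks_succ
      (e (n + 1) - a (n + 1)).toNat
    · rw [Int.toNat_of_nonneg (by omega), add_sub_cancel] at this
      rw [blocks_succ (n + 1) a e, this, blocks_succ, carried]
    · obtain ⟨i, hi, h1, h2⟩ := mem_blocks.1 hy
      have h3 := h.1 (i + 1) (by omega)
      have h4 : e (i + 1) ≤ e n := by
        rcases (Nat.succ_le_of_lt hi).eq_or_lt with h5 | h5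
        · rw [← h5]
        · exact (h.end_lt_end h5 (by omega)).le
      omega

/-! ### The ultradiscrete Toda molecule -/

/-- One time step of the ultradiscrete Toda molecule with `n` sites. -/
def TodaStep (n : ℕ) (Q W Q' W' : ℕ → ℤ) : Prop :=
  ∃ X : ℕ → ℤ, X 0 = Q 0 ∧
    (∀ i, i + 1 < n → Q' i = min (X i) (W i) ∧ X (i + 1) = X i - Q' i + Q (i + 1) ∧
      W' i = Q (i + 1) + W i - Q' i) ∧
    ∀ i, i + 1 = n → Q' i = X i

/-- The evolution of the ultradiscrete Toda molecule is injective. -/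
theorem TodaStep.injective {n : ℕ} {Q W Q' W' R V R' V' : ℕ → ℤ} (h : TodaStep n Q W Q' W')
    (h' : TodaStep n R V R' V') (hQ : ∀ i < n, Q' i = R' i) (hW : ∀ i, i + 1 < n → W' i = V' i) :
    (∀ i < n, Q i = R i) ∧ ∀ i, i + 1 < n → W i = V i := by
  obtain ⟨X, hX0, hX, hXn⟩ := h
  obtain ⟨Y, hY0, hY, hYn⟩ := h'
  -- The loads are recovered from the right: the last one is the last new size, and `X i = Q' i +
  -- max (X (i + 1) - W' i) 0`.
  have key : ∀ j i, i + 1 + j = n → X i = Y i := by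
    intro j
    induction j with
    | zero =>
      intro i hi
      rw [← hXn i hi, ← hYn i hi, hQ i (by omega)]
    | succ j ih =>
      intro i hi
      have h1 := ih (i + 1) (by omega)
      have h2 := hX i (by omega)
      have h3 := hY i (by omega)
      have h4 := hQ i (by omega)
      have h5 := hW i (by omega)
      omega
  have hQR : ∀ i < n, Q i = R i := by
    rintro (_ | i) hi
    · rw [← hX0, ← hY0, key (n - 1) 0 (by omega)]
    · have h1 := key (n - 1 - (i + 1)) (i + 1) (by omega)
      have h0 := key (n - 1 - i) i (by omega)
      have h2 := hX i hi
      have h3 := hY i hi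
      have h4 := hQ i (by omega)
      omega
  refine ⟨hQR, fun i hi => ?_⟩
  have h1 := hQR (i + 1) hi
  have h2 := hX i hi
  have h3 := hY i hi
  have h4 := hQ i (by omega)
  have h5 := hW i hi
  omega

theorem Interlaced.exists_evolve {n : ℕ} {a e : ℕ → ℤ} (h : Interlaced n a e) :
    ∃ a' e', Interlaced n a' e' ∧ evolve (blocks n a e) = blocks n a' e' ∧
      TodaStep n (fun i => e i - a i) (fun i => a (i + 1) - e i)
        (fun i => e' i - a' i) (fun i => a' (i + 1) - e' i) := by
  rcases n with _ | n
  · exact ⟨a, e, h, evolve_empty, fun i => e i - a i, rfl, by simp, by simp⟩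
  set f : ℕ → ℤ := fun i => if i = n then e i + carried a e i else
    e i + min (carried a e i) (a (i + 1) - e i) with hf
  have hf1 : ∀ i, i < n → f i = e i + min (carried a e i) (a (i + 1) - e i) := fun i hi => by
    simp [hf, hi.ne]
  have hf2 : f n = e n + carried a e n := by simp [hf]
  refine ⟨e, f, ⟨fun i hi => ?_, fun i hi => ?_⟩, ?_, carried a e, rfl, fun i hi => ?_,
    fun i hi => ?_⟩
  · have h1 := h.carried_pos i hi
    rcases (Nat.lt_succ_iff.1 hi).eq_or_lt with rfl | hi'
    · omega
    · have := h.2 i (by omega)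
      rw [hf1 i hi']
      omega
  · rw [hf1 i (by omega)]
    have := h.1 (i + 1) hi
    omega
  · rw [h.evolve_blocks_succ, blocks_succ, hf2]
    congr 1
    exact blocks_congr (fun _ _ => rfl) fun i hi => (hf1 i hi).symm
  · dsimp only
    rw [hf1 i (by omega), carried]
    omega
  · obtain rfl : i = n := by omega
    dsimp only
    rw [hf2]
    omega

theorem numBlocks_evolve (s : State) : numBlocks (evolve s) = numBlocks s := by
  obtain ⟨n, a, e, h, rfl⟩ := exists_blocks s
  obtain ⟨a', e', h', he, -⟩ := h.exists_evolve
  rw [he, h.numBlocks_eq, h'.numBlocks_eq]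

theorem todaStep_congr {n : ℕ} {Q W Q' W' R V R' V' : ℕ → ℤ} (h : TodaStep n Q W Q' W')
    (hQ : ∀ i < n, Q i = R i) (hW : ∀ i, i + 1 < n → W i = V i)
    (hQ' : ∀ i < n, Q' i = R' i) (hW' : ∀ i, i + 1 < n → W' i = V' i) (hn : 0 < n) :
    TodaStep n R V R' V' := by
  obtain ⟨X, h0, h1, h2⟩ := h
  refine ⟨X, by rw [h0, hQ 0 hn], fun i hi => ?_, fun i hi => ?_⟩
  · rw [← hQ (i + 1) hi, ← hW i hi, ← hQ' i (by omega), ← hW' i hi]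
    exact h1 i hi
  · rw [← hQ' i (by omega)]
    exact h2 i hi

theorem todaStep_evolve {s : State} {n : ℕ} (hn : numBlocks s = n) (hpos : 0 < n) :
    TodaStep n (fun i => blockSize s (i + 1)) (fun i => gapSize s (i + 1))
      (fun i => blockSize (evolve s) (i + 1)) (fun i => gapSize (evolve s) (i + 1)) := by
  obtain ⟨n', a, e, h, rfl⟩ := exists_blocks s
  obtain rfl : n' = n := by rw [← hn, h.numBlocks_eq]
  obtain ⟨a', e', h', he, hT⟩ := h.exists_evolve
  rw [he]
  refine todaStep_congr hT ?_ ?_ ?_ ?_ hpos <;> intro i hi <;> simp only [blockSize, gapSize]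
  · rw [h.blockStart_eq hi, h.blockEnd_eq hi]
  · rw [h.blockStart_eq hi, h.blockEnd_eq (by omega)]
  · rw [h'.blockStart_eq hi, h'.blockEnd_eq hi]
  · rw [h'.blockStart_eq hi, h'.blockEnd_eq (by omega)]

end BoxBall

/-! ### Explicit solutions and their asymptotics -/

namespace BoxBall

open Finset Filter

section explicit

variable (c m : ℕ → ℤ) (n : ℕ)

/-- The block sizes of the explicit solution of the ultradiscrete Toda molecule. -/
noncomputable def tauSize (t : ℤ) (i : ℕ) : ℤ :=
  tau c m n (i + 1) (t + 1) - tau c m n (i + 1) t - (tau c m n i (t + 1) - tau c m n i t)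

/-- The gap sizes of the explicit solution of the ultradiscrete Toda molecule. -/
noncomputable def tauGap (t : ℤ) (i : ℕ) : ℤ :=
  tau c m n (i + 2) t + tau c m n i (t + 1) - tau c m n (i + 1) t - tau c m n (i + 1) (t + 1)

variable {c m n}

/-- The minimum in the Toda step is `tau_bilinear` at time `t + 1`. The boundary conditions hold
because the tau function is zero for `k = 0` and affine in time for `k = n`. -/
theorem todaStep_tau (hm : Monotone m) (t : ℤ) :
    TodaStep n (tauSize c m n t) (tauGap c m n t)
      (tauSize c m n (t + 1)) (tauGap c m n (t + 1)) := by
  refine ⟨fun i => tau c m n (i + 1) (t + 1) - tau c m n (i + 1) t -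
    (tau c m n i (t + 2) - tau c m n i (t + 1)), ?_, fun i hi => ⟨?_, ?_, ?_⟩, ?_⟩
  · simp only [tauSize, tau_zero]
  · have h := tau_bilinear (c := c) hm (k := i) hi (t + 1)
    simp only [tauSize, tauGap]
    rw [add_sub_cancel_right, show t + 1 + 1 = t + 2 by ring] at h
    rw [show t + 1 + 1 = t + 2 by ring]
    omega
  · simp only [tauSize]
    rw [show t + 1 + 1 = t + 2 by ring]
    ring
  · simp only [tauSize, tauGap]
    rw [show t + 1 + 1 = t + 2 by ring]
    ring
  · rintro i rfl
    have h := tau_self_linear (c := c) (m := m) (n := i + 1) t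
    simp only [tauSize]
    rw [show t + 1 + 1 = t + 2 by ring]
    omega

theorem eventually_tau_atTop (hlt : ∀ i j, i < j → j < n → m i < m j) :
    ∀ᶠ t in atTop, ∀ k ≤ n, tau c m n k t = weight c m t (range k) := by
  have h : ∀ᶠ t in atTop, ∀ k ∈ range (n + 1), tau c m n k t = weight c m t (range k) := by
    refine (eventually_all_finset _).2 fun k hk => ?_
    rw [mem_range, Nat.lt_succ_iff] at hk
    refine eventually_tau_eq_atTop (range_subset_range.2 hk) (card_range k) fun i hi j hj => ?_
    simp only [mem_range, Finset.mem_sdiff] at hi hj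
    exact hlt i j (by omega) hj.1
  filter_upwards [h] with t ht k hk
  exact ht k (mem_range.2 (by omega))

theorem eventually_tau_atBot (hlt : ∀ i j, i < j → j < n → m i < m j) :
    ∀ᶠ t in atBot, ∀ k ≤ n, tau c m n k t = weight c m t (Ico (n - k) n) := by
  have h : ∀ᶠ t in atBot, ∀ k ∈ range (n + 1),
      tau c m n k t = weight c m t (Ico (n - k) n) := by
    refine (eventually_all_finset _).2 fun k hk => ?_
    rw [mem_range, Nat.lt_succ_iff] at hk
    refine eventually_tau_eq_atBot (fun i hi => mem_range.2 (mem_Ico.1 hi).2) (by simp; omega)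
      fun i hi j hj => ?_
    simp only [mem_range, Finset.mem_sdiff, mem_Ico] at hi hj
    exact hlt j i (by omega) (by omega)
  filter_upwards [h] with t ht k hk
  exact ht k (mem_range.2 (by omega))

theorem eventually_tauSize_atTop (hlt : ∀ i j, i < j → j < n → m i < m j) :
    ∀ᶠ t in atTop, ∀ i < n, tauSize c m n t i = m i := by
  have h := eventually_tau_atTop (c := c) hlt
  filter_upwards [h, (tendsto_atTop_add_const_right _ 1 tendsto_id).eventually h] with t h0 h1 i hi
  simp only [id] at h1
  rw [tauSize, h0 _ hi, h1 _ hi, h0 _ hi.le, h1 _ hi.le, weight_range_succ, weight_range_succ]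
  ring

theorem eventually_tauGap_atTop (hlt : ∀ i j, i < j → j < n → m i < m j) :
    ∀ᶠ t in atTop, ∀ i, i + 1 < n →
      tauGap c m n t i = c (i + 1) - c i + t * (m (i + 1) - m i) + m i := by
  have h := eventually_tau_atTop (c := c) hlt
  filter_upwards [h, (tendsto_atTop_add_const_right _ 1 tendsto_id).eventually h] with t h0 h1 i hi
  simp only [id] at h1
  rw [tauGap, h0 _ hi, h1 i (by omega), h0 _ hi.le, h1 _ hi.le, weight_range_succ (i + 1),
    weight_range_succ, weight_range_succ, sum_range_succ]
  ring

theorem eventually_tauSize_atBot (hlt : ∀ i j, i < j → j < n → m i < m j) :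
    ∀ᶠ t in atBot, ∀ i < n, tauSize c m n t i = m (n - 1 - i) := by
  have h := eventually_tau_atBot (c := c) hlt
  filter_upwards [h, (tendsto_atBot_add_const_right _ 1 tendsto_id).eventually h] with t h0 h1 i hi
  simp only [id] at h1
  rw [tauSize, h0 _ hi, h1 _ hi, h0 _ hi.le, h1 _ hi.le,
    weight_Ico_pred (show n - (i + 1) < n by omega), weight_Ico_pred (show n - (i + 1) < n by omega),
    show n - (i + 1) + 1 = n - i by omega, show n - (i + 1) = n - 1 - i by omega]
  ring

/-- The phase shift originates here: the lowest member of a top segment of size `k` interacts with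
the `k - 1` others, contributing `2 * (k - 1)` times its own `m`. -/
theorem eventually_tauGap_atBot (hlt : ∀ i j, i < j → j < n → m i < m j) :
    ∀ᶠ t in atBot, ∀ i, i + 1 < n →
      tauGap c m n t i = c (n - 2 - i) - c (n - 1 - i) + t * (m (n - 2 - i) - m (n - 1 - i)) +
        2 * (i + 1) * m (n - 2 - i) - (2 * i + 1) * m (n - 1 - i) := by
  have h := eventually_tau_atBot (c := c) hlt
  filter_upwards [h, (tendsto_atBot_add_const_right _ 1 tendsto_id).eventually h] with t h0 h1 i hi
  simp only [id] at h1
  rw [tauGap, h0 _ hi, h1 i (by omega), h0 _ hi.le, h1 _ hi.le,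
    weight_Ico_pred (show n - (i + 2) < n by omega), show n - (i + 2) + 1 = n - (i + 1) by omega,
    weight_Ico_pred (show n - (i + 1) < n by omega) (t + 1),
    show n - (i + 1) + 1 = n - i by omega, show n - (i + 1) = n - 1 - i by omega,
    show n - (i + 2) = n - 2 - i by omega, show n - 2 - i = n - (i + 2) by omega,
    show n - 1 - i = n - (i + 1) by omega, Nat.cast_sub hi, Nat.cast_sub hi.le]
  push_cast
  ring

end explicit

/-! ### Matching an orbit with an explicit solution -/

theorem numBlocks_orbit {η : ℤ → State} (hη : IsOrbit η) (s t : ℤ) :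
    numBlocks (η s) = numBlocks (η t) := by
  have h : ∀ t, numBlocks (η t) = numBlocks (η 0) := by
    intro t
    induction t using Int.induction_on with
    | zero => rfl
    | succ i ih => rw [hη, numBlocks_evolve, ih]
    | pred i ih => rw [← ih, ← numBlocks_evolve, ← hη, sub_add_cancel]
  rw [h s, h t]

/-- Two orbits of the ultradiscrete Toda molecule that agree at one time agree before it. -/
theorem todaStep_backward_unique {n : ℕ} {Q W R V : ℤ → ℕ → ℤ}
    (h : ∀ t, TodaStep n (Q t) (W t) (Q (t + 1)) (W (t + 1)))
    (h' : ∀ t, TodaStep n (R t) (V t) (R (t + 1)) (V (t + 1))) {t₀ : ℤ}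
    (hQ : ∀ i < n, Q t₀ i = R t₀ i) (hW : ∀ i, i + 1 < n → W t₀ i = V t₀ i) {t : ℤ}
    (ht : t ≤ t₀) : (∀ i < n, Q t i = R t i) ∧ ∀ i, i + 1 < n → W t i = V t i := by
  induction t, ht using Int.leInductionDown with
  | base => exact ⟨hQ, hW⟩
  | pred t _ ih =>
    have h1 := h (t - 1)
    have h2 := h' (t - 1)
    rw [sub_add_cancel] at h1 h2
    exact h1.injective h2 ih.1 ih.2

/-- An integer-valued function with a real limit is eventually equal to an integer. -/
theorem exists_int_eventually_eq {f : ℤ → ℤ} {x : ℝ}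
    (h : Tendsto (fun t => (f t : ℝ)) atTop (nhds x)) :
    ∃ z : ℤ, (z : ℝ) = x ∧ ∀ᶠ t in atTop, f t = z := by
  obtain ⟨z, rfl⟩ : x ∈ Set.range ((↑) : ℤ → ℝ) :=
    Int.isClosedEmbedding_coe_real.isClosed_range.mem_of_tendsto h
      (Eventually.of_forall fun t => ⟨f t, rfl⟩)
  refine ⟨z, rfl, ?_⟩
  have h' := Int.isClosedEmbedding_coe_real.isInducing.tendsto_nhds_iff.2 h
  rwa [nhds_discrete, tendsto_pure] at h'

/-- The phase shift of the ultradiscrete Toda molecule: forward asymptotics in terms of `m`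
determine the sum of the gaps at times `t` and `-t`. -/
theorem eventually_gap_add_gap {n : ℕ} {m : ℕ → ℤ} {Q W : ℤ → ℕ → ℤ}
    (h : ∀ t, TodaStep n (Q t) (W t) (Q (t + 1)) (W (t + 1)))
    (hm : Monotone m) (hlt : ∀ i j, i < j → j < n → m i < m j)
    (hQ : ∀ᶠ t in atTop, ∀ i < n, Q t i = m i) {k l : ℕ} (hn : k + l + 2 = n) :
    ∀ᶠ t in atTop, W t l + Q t l + W (-t) k + Q (-t) k + 2 * t * (m l - m (l + 1)) =
      2 * (k + 2) * m l - 2 * k * m (l + 1) := by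
  obtain ⟨t₀, ht₀⟩ := eventually_atTop.1 hQ
  have hW : ∀ t ≥ t₀, ∀ i, i + 1 < n → W t i = W t₀ i + (t - t₀) * (m (i + 1) - m i) := by
    intro t ht i hi
    induction t, ht using Int.leInduction with
    | base => ring
    | succ t ht ih =>
      obtain ⟨X, -, hX, -⟩ := h t
      rw [(hX i hi).2.2, ih, ht₀ t ht _ hi, ht₀ (t + 1) (by omega) _ (by omega)]
      ring
  -- The forward gap formula prescribes the differences of `c`, so `c` is their partial sum.
  set c : ℕ → ℤ := fun i => ∑ j ∈ range i, (W t₀ j - t₀ * (m (j + 1) - m j) - m j) with hc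
  have hc' : ∀ i, c (i + 1) - c i = W t₀ i - t₀ * (m (i + 1) - m i) - m i := fun i => by
    simp only [hc, sum_range_succ]
    ring
  obtain ⟨t₁, h0, h1, h2⟩ := ((eventually_ge_atTop t₀).and
    ((eventually_tauSize_atTop (c := c) hlt).and
      (eventually_tauGap_atTop (c := c) hlt))).exists
  have hback : ∀ t ≤ t₁, (∀ i < n, Q t i = tauSize c m n t i) ∧
      ∀ i, i + 1 < n → W t i = tauGap c m n t i := fun t ht =>
    todaStep_backward_unique h (todaStep_tau hm)
      (fun i hi => by rw [h1 i hi, ht₀ t₁ h0 i hi])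
      (fun i hi => by rw [h2 i hi, hW t₁ h0 i hi, hc']; ring) ht
  filter_upwards [eventually_ge_atTop t₀, eventually_ge_atTop (-t₁),
    tendsto_neg_atTop_atBot.eventually (eventually_tauSize_atBot (c := c) hlt),
    tendsto_neg_atTop_atBot.eventually (eventually_tauGap_atBot (c := c) hlt)] with t ht ht' h3 h4
  obtain ⟨h5, h6⟩ := hback (-t) (by omega)
  have e1 : n - 1 - k = l + 1 := by omega
  have e2 : n - 2 - k = l := by omega
  have h7 := hc' l
  rw [hW t ht l (by omega), ht₀ t ht l (by omega), h5 k (by omega), h6 k (by omega),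
    h3 k (by omega), h4 k (by omega), e1, e2]
  -- The difference of the phases `l` and `l + 1` enters the two gaps with opposite signs.
  linear_combination -h7

end BoxBall

/-! ### The limit in the original indexing -/

open BoxBall in
theorem mainTheorem4 (η : ℤ → State) (hη : IsOrbit η)
    (n : ℕ) (μ : ℕ → ℝ) (hμ : HasAsymptoticBlockSizes η n μ)
    (hlt : StrictMonoOn μ (Set.Icc 1 n))
    (k : ℕ) (hk : 1 ≤ k) (hkn : k < n) :
    Filter.Tendsto
      (fun t : ℤ =>
        (gapSize (η t) (n - k) : ℝ) + (blockSize (η t) (n - k) : ℝ)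
          + (gapSize (η (-t)) k : ℝ) + (blockSize (η (-t)) k : ℝ)
          + 2 * (t : ℝ) * (μ (n - k) - μ (n - k + 1)))
      Filter.atTop
      (nhds
        ((∑ j ∈ Finset.Icc 1 n with j < k + 1, 2 * μ (n - k))
          + (∑ j ∈ Finset.Icc 1 n with k < j, 2 * μ (n - j + 1))
          - (∑ j ∈ Finset.Icc 1 n with k + 1 < j, 2 * μ (n - j + 1))
          - (∑ j ∈ Finset.Icc 1 n with j < k, 2 * μ (n - k + 1)))) := by
  obtain ⟨hnum, hsize⟩ := hμ
  have hn : ∀ t, numBlocks (η t) = n := by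
    obtain ⟨s, hs⟩ := hnum.exists
    exact fun t => (numBlocks_orbit hη t s).trans hs
  have hex : ∀ i ∈ Finset.range n, ∃ z : ℤ, (z : ℝ) = μ (i + 1) ∧
      ∀ᶠ t in Filter.atTop, blockSize (η t) (i + 1) = z := fun i hi =>
    exists_int_eventually_eq (hsize (i + 1)
      (Finset.mem_Icc.2 ⟨by omega, Finset.mem_range.1 hi⟩))
  choose! m₀ hm₀ hev using hex
  -- Clamping the index makes `m` monotone on all of `ℕ`, as the bilinear identity requires.
  set m : ℕ → ℤ := fun i => m₀ (min i (n - 1)) with hm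
  have hmμ : ∀ i < n, (m i : ℝ) = μ (i + 1) := fun i hi => by
    rw [← hm₀ i (Finset.mem_range.2 hi), hm]
    dsimp only
    rw [min_eq_left (by omega)]
  have hmlt : ∀ i j, i < j → j < n → m i < m j := fun i j hij hj => by
    have := hlt (a := i + 1) (b := j + 1) ⟨by omega, by omega⟩ ⟨by omega, by omega⟩ (by omega)
    rw [← hmμ i (by omega), ← hmμ j hj] at this
    exact_mod_cast this
  have hmono : Monotone m := by
    refine monotone_nat_of_le_succ fun i => ?_
    by_cases hi : i + 1 < n
    · exact (hmlt i (i + 1) (by omega) hi).le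
    · simp only [hm]
      rw [min_eq_right (by omega), min_eq_right (by omega)]
  have hQ : ∀ᶠ t in Filter.atTop, ∀ i < n, blockSize (η t) (i + 1) = m i := by
    have := (Filter.eventually_all_finset (Finset.range n)).2 hev
    filter_upwards [this] with t ht i hi
    rw [ht i (Finset.mem_range.2 hi), hm]
    dsimp only
    rw [min_eq_left (by omega)]
  obtain ⟨l, rfl⟩ : ∃ l, n = k + l + 1 := ⟨n - k - 1, by omega⟩
  obtain ⟨k, rfl⟩ : ∃ k', k = k' + 1 := ⟨k - 1, by omega⟩
  have hmain := eventually_gap_add_gap (Q := fun t i => blockSize (η t) (i + 1))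
    (W := fun t i => gapSize (η t) (i + 1)) (fun t => by
      rw [hη t]
      exact todaStep_evolve (hn t) (by omega)) hmono hmlt hQ
    (show k + l + 2 = k + 1 + l + 1 by ring)
  refine tendsto_const_nhds.congr' ?_
  filter_upwards [hmain] with t ht
  have e1 : k + 1 + l + 1 - (k + 1) = l + 1 := by omega
  have hs1 : (Finset.Icc 1 (k + 1 + l + 1)).filter (· < k + 1 + 1) = Finset.Icc 1 (k + 1) := by
    ext; simp only [Finset.mem_filter, Finset.mem_Icc]; omega
  have hs2 : (Finset.Icc 1 (k + 1 + l + 1)).filter (· < k + 1) = Finset.Icc 1 k := by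
    ext; simp only [Finset.mem_filter, Finset.mem_Icc]; omega
  -- The second and third sums differ in a single term, which is one more copy of `2 * μ (l + 1)`.
  have hs3 : (Finset.Icc 1 (k + 1 + l + 1)).filter (k + 1 < ·) =
      insert (k + 2) ((Finset.Icc 1 (k + 1 + l + 1)).filter (k + 1 + 1 < ·)) := by
    ext; simp only [Finset.mem_filter, Finset.mem_Icc, Finset.mem_insert]; omega
  rw [hs1, hs2, hs3, Finset.sum_insert (by simp), e1,
    show k + 1 + l + 1 - (k + 2) + 1 = l + 1 by omega, ← hmμ l (by omega),
    ← hmμ (l + 1) (by omega)]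
  simp only [Finset.sum_const, Nat.card_Icc, nsmul_eq_mul]
  have ht' := congrArg (Int.cast : ℤ → ℝ) ht
  push_cast at ht' ⊢
  linear_combination -ht'
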